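/- Let $p\ge 1$ and let $\varepsilon_{ij}$, $i\in\mathbb Z$, $1\le j\le p$, be i.i.d. real random variables with $\mathbb E\,\varepsilon_{ij}=0$ and $\mathbb E\,\varepsilon_{ij}^2=\sigma^2<\infty$; write $\boldsymbol\varepsilon_i=(\varepsilon_{i1},\dots,\varepsilon_{ip})^\top$. Let $\mu\in\mathbb R^p$, let $A_k\in\mathbb R^{p\times p}$ for $k\ge 0$, and let $$X_i=\mu+\sum_{k=0}^\infty A_k\boldsymbol\varepsilon_{i-k},\qquad i\in\mathbb Z,$$ be the associated stationary linear process (the series converges almost surely). Assume that for some $0<\rho_0<1$, $\gamma<\infty$ and $1\le\tau\le n$, where $n$ is a positive integer, the spectral norms satisfy $\|A_k\|\le\gamma\,\rho_0^{k/\tau}$ for all $k\ge 0$. Let $G:\mathbb R^p\to\mathbb R$ satisfy $|G(u)|\le M$ for all $u\in\mathbb R^p$, and suppose there are weights $g_1,\dots,g_p\ge 0$ with $\sum_{j=1}^p g_j=1$ such that $$|G(u)-G(v)|\le\sum_{j=1}^p g_j|u_j-v_j|\qquad\text{for all }u,v\in\mathbb R^p.$$ Then for every $x>0$, $$\mathbb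 P\Big(\sum_{i=1}^n\big(G(X_i)-\mathbb E\,G(X_i)\big)\ge x\Big)\le 2\exp\Big\{-\frac{x^2}{C_1 n\sigma^2\tau^2\gamma^2+C_2\tau Mx}\Big\},$$ where $$C_1=\frac{16e^2}{\sqrt{2\pi}\,\rho_0^4[\log(1/\rho_0)]^3},\qquad C_2=\frac{8e}{\log(1/\rho_0)}.$$ (If the denominator in the exponent is $0$, the exponent is read as $0$.) -/

import Mathlib

open MeasureTheory ProbabilityTheory Filter Topology

noncomputable section

/-- The spectral norm `‖A‖ = sup_{x ≠ 0} |A x|₂ / |x|₂` of a real square matrix: the operator norm of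
`x ↦ A x` on Euclidean space. -/
def matSpectralNorm {p : ℕ} (A : Matrix (Fin p) (Fin p) ℝ) : ℝ :=
  ‖Matrix.toEuclideanCLM (n := Fin p) (𝕜 := ℝ) A‖

/-- The variables `ε i j` (`i ∈ ℤ`, `1 ≤ j ≤ p`) are i.i.d. real random variables (jointly in both
indices), square integrable, with mean zero and variance `σ ^ 2`. -/
structure IsIIDInnovation {Ω : Type*} [MeasurableSpace Ω] (P : Measure Ω) {p : ℕ}
    (σ : ℝ) (ε : ℤ → Fin p → Ω → ℝ) : Prop where
  measurable : ∀ i j, Measurable (ε i j)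
  indep : iIndepFun (fun a : ℤ × Fin p => ε a.1 a.2) P
  identDistrib : ∀ i j i' j', IdentDistrib (ε i j) (ε i' j') P P
  memLp_two : ∀ i j, MemLp (ε i j) 2 P
  mean_zero : ∀ i j, ∫ ω, ε i j ω ∂P = 0
  second_moment : ∀ i j, ∫ ω, (ε i j ω) ^ 2 ∂P = σ ^ 2

/-- `X` is the linear process `X i = μ + ∑_{k ≥ 0} A k ε_{i - k}`, the series converging almost
surely (as the limit of its partial sums) for every time `i`. -/
def IsLinearProcess {Ω : Type*} [MeasurableSpace Ω] (P : Measure Ω) {p : ℕ}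
    (μ : Fin p → ℝ) (A : ℕ → Matrix (Fin p) (Fin p) ℝ) (ε : ℤ → Fin p → Ω → ℝ)
    (X : ℤ → Ω → Fin p → ℝ) : Prop :=
  ∀ i : ℤ, ∀ᵐ ω ∂P,
    Tendsto
      (fun N : ℕ => μ + ∑ k ∈ Finset.range N,
        Matrix.mulVec (A k) (fun j => ε (i - (k : ℤ)) j ω))
      atTop (𝓝 (X i ω))

/-- The constant `C₁ = 16 e² / (√(2π) ρ₀⁴ [log (1/ρ₀)]³)`. -/
def bernsteinC₁ (ρ₀ : ℝ) : ℝ :=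
  16 * Real.exp 1 ^ 2 / (Real.sqrt (2 * Real.pi) * ρ₀ ^ 4 * Real.log (1 / ρ₀) ^ 3)

/-- The constant `C₂ = 8 e / log (1/ρ₀)`. -/
def bernsteinC₂ (ρ₀ : ℝ) : ℝ :=
  8 * Real.exp 1 / Real.log (1 / ρ₀)

end

/-! The mechanism is a Chernoff bound in which independence is used one innovation at a time. If
only finitely many innovations drive the process, the centred sum is a function of independent
vectors. Integrating them out successively bounds its exponential moment by a product of factors
`exp (E ψ(t W))`, one per innovation, where `ψ u = exp u - 1 - u` and `W` bounds the change of the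
sum when that innovation is replaced by an independent copy (`integral_exp_centered_le`,
`integral_exp_sum_centered_le`).

The innovation at time `n - k` reaches the summand at time `n - i` only through the lag `k - i`, and
changes it by at most the minimum of `2 M` and a Lipschitz gap. The cap makes two moments of the
noise suffice: a high moment of one term costs powers of `2 M` times its second moment, which decays
like `exp (-α * lag)` with `α = 2 log(1/ρ₀) / τ`. Adding the terms in L^p gives `E W^p` of order
`(p/α)^p` (`integral_sum_pow_le`). The factorials of the exponential series absorb this growth, so
`E ψ(t W)` has the Bernstein form `t² / (1 - b t)` (`integral_exp_sub_one_sub_le`).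

Innovations inside the sample contribute equally and earlier ones decay geometrically, whence the
total weight `n + 1/α`. The bound does not depend on the number of innovations kept, so dominated
convergence carries it to the full process; optimizing in `t` and comparing constants finishes. -/

/-! ### Symmetrization for a single random variable -/

theorem exp_sub_one_sub_abs_le (u : ℝ) :
    Real.exp u ≤ 1 + u + (Real.exp |u| - 1 - |u|) := by
  rcases le_total 0 u with h | h
  · rw [abs_of_nonneg h]; linarith
  · rw [abs_of_nonpos h]
    have h1 := Real.self_le_sinh_iff.2 (neg_nonneg.2 h)
    rw [Real.sinh_eq, neg_neg] at h1
    linarith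

theorem exp_sub_one_sub_mono {u v : ℝ} (hu : 0 ≤ u) (huv : u ≤ v) :
    Real.exp u - 1 - u ≤ Real.exp v - 1 - v := by
  have h1 : Real.exp v = Real.exp u * Real.exp (v - u) := by rw [← Real.exp_add]; ring_nf
  have h2 := Real.add_one_le_exp (v - u)
  have h3 := Real.one_le_exp hu
  nlinarith

theorem integrable_of_abs_le {α : Type*} [MeasurableSpace α] {μ : Measure α} [IsFiniteMeasure μ]
    {f : α → ℝ} (hf : Measurable f) (C : ℝ) (h : ∀ a, |f a| ≤ C) : Integrable f μ :=
  Integrable.of_bound hf.aestronglyMeasurable C (ae_of_all _ fun a => by simpa using h a)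

theorem abs_integral_le_of_abs_le {α : Type*} [MeasurableSpace α] {μ : Measure α}
    [IsProbabilityMeasure μ] {f : α → ℝ} {C : ℝ} (h : ∀ a, |f a| ≤ C) : |∫ a, f a ∂μ| ≤ C := by
  simpa using norm_integral_le_of_norm_le_const (μ := μ)
    (ae_of_all _ fun a => (Real.norm_eq_abs (f a)).trans_le (h a))

/-- Symmetrization: the exponential moment of a centred bounded function is controlled by
the oscillations of the function. -/
theorem integral_exp_centered_le {E : Type*} [MeasurableSpace E] (ν : Measure E)
    [IsProbabilityMeasure ν] {h : E → ℝ} (hm : Measurable h) {C : ℝ} (hC : ∀ a, |h a| ≤ C)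
    {w : E × E → ℝ} (hwm : Measurable w) {H : ℝ} (hwH : ∀ z, w z ≤ H)
    (hw : ∀ a b, |h a - h b| ≤ w (a, b)) {t : ℝ} (ht : 0 ≤ t) :
    ∫ a, Real.exp (t * (h a - ∫ b, h b ∂ν)) ∂ν ≤
      Real.exp (∫ z, (Real.exp (t * w z) - 1 - t * w z) ∂(ν.prod ν)) := by
  set m := ∫ b, h b ∂ν with hmdef
  have hmC : |m| ≤ C := abs_integral_le_of_abs_le hC
  have hw0 : ∀ z, 0 ≤ w z := fun z => (abs_nonneg _).trans (hw z.1 z.2)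
  have hint : Integrable h ν := integrable_of_abs_le hm C hC
  have hexp_int : ∀ {f : E → ℝ}, Measurable f → (∀ a, f a ≤ 2 * C) →
      Integrable (fun a => Real.exp (t * f a)) ν := fun hf hb =>
    integrable_of_abs_le (by fun_prop) (Real.exp (t * (2 * C))) fun a => by
      rw [Real.abs_exp]
      exact Real.exp_le_exp.2 (mul_le_mul_of_nonneg_left (hb a) ht)
  have h1 : Integrable (fun a => Real.exp (t * (h a - m))) ν :=
    hexp_int (by fun_prop) fun a => by
      have := abs_le.1 (hC a); have := abs_le.1 hmC; linarith
  have h2 : Integrable (fun b => Real.exp (t * (m - h b))) ν :=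
    hexp_int (by fun_prop) fun a => by
      have := abs_le.1 (hC a); have := abs_le.1 hmC; linarith
  have hlin : Integrable (fun b => t * (m - h b)) ν :=
    ((integrable_const m).sub hint).const_mul t
  -- Jensen: an independent copy may be multiplied in without decreasing the exponential moment.
  have hone : 1 ≤ ∫ b, Real.exp (t * (m - h b)) ∂ν := by
    have h3 : ∫ b, (t * (m - h b) + 1) ∂ν ≤ ∫ b, Real.exp (t * (m - h b)) ∂ν :=
      integral_mono (hlin.add (integrable_const 1)) h2 fun b => Real.add_one_le_exp _
    have h4 : ∫ b, (t * (m - h b) + 1) ∂ν = 1 := by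
      rw [integral_add hlin (integrable_const 1),
        integral_const_mul, integral_sub (integrable_const m) hint]
      simp [← hmdef]
    linarith
  have hfst : Integrable (fun z : E × E => h z.1) (ν.prod ν) :=
    integrable_of_abs_le (by fun_prop) C fun z => hC z.1
  have hsnd : Integrable (fun z : E × E => h z.2) (ν.prod ν) :=
    integrable_of_abs_le (by fun_prop) C fun z => hC z.2
  have hψ : Integrable (fun z => Real.exp (t * w z) - 1 - t * w z) (ν.prod ν) := by
    have e1 : Integrable (fun z => Real.exp (t * w z)) (ν.prod ν) :=
      integrable_of_abs_le (by fun_prop) (Real.exp (t * H)) fun z => by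
        rw [Real.abs_exp]
        exact Real.exp_le_exp.2 (mul_le_mul_of_nonneg_left (hwH z) ht)
    have e2 : Integrable (fun z => t * w z) (ν.prod ν) :=
      (integrable_of_abs_le hwm H fun z => by rw [abs_of_nonneg (hw0 z)]; exact hwH z).const_mul t
    exact (e1.sub (integrable_const 1)).sub e2
  have hsub : ∫ z : E × E, t * (h z.1 - h z.2) ∂(ν.prod ν) = 0 := by
    rw [integral_const_mul, integral_sub hfst hsnd, integral_fun_fst (μ := ν) (ν := ν) h,
      integral_fun_snd (μ := ν) (ν := ν) h]
    simp
  have hdif : Integrable (fun z : E × E => t * (h z.1 - h z.2)) (ν.prod ν) :=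
    (hfst.sub hsnd).const_mul t
  have hdif' : Integrable (fun z : E × E => 1 + t * (h z.1 - h z.2)) (ν.prod ν) :=
    (integrable_const 1).add hdif
  calc ∫ a, Real.exp (t * (h a - m)) ∂ν
      ≤ (∫ a, Real.exp (t * (h a - m)) ∂ν) * ∫ b, Real.exp (t * (m - h b)) ∂ν :=
        le_mul_of_one_le_right (integral_nonneg fun _ => (Real.exp_pos _).le) hone
    _ = ∫ z : E × E, Real.exp (t * (h z.1 - m)) * Real.exp (t * (m - h z.2)) ∂(ν.prod ν) :=
        (integral_prod_mul _ _).symm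
    _ ≤ ∫ z : E × E, (1 + t * (h z.1 - h z.2) + (Real.exp (t * w z) - 1 - t * w z))
          ∂(ν.prod ν) := by
        refine integral_mono (h1.mul_prod h2) (hdif'.add hψ) fun z => ?_
        dsimp only
        rw [← Real.exp_add,
          show t * (h z.1 - m) + t * (m - h z.2) = t * (h z.1 - h z.2) by ring]
        -- The linear term keeps its sign, so it integrates to zero by symmetry; only the remainder
        -- is replaced by its value at `t * w z`.
        refine (exp_sub_one_sub_abs_le _).trans (add_le_add_right ?_ _)
        refine exp_sub_one_sub_mono (abs_nonneg _) ?_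
        rw [abs_mul, abs_of_nonneg ht]
        exact mul_le_mul_of_nonneg_left (hw z.1 z.2) ht
    _ = 1 + ∫ z, (Real.exp (t * w z) - 1 - t * w z) ∂(ν.prod ν) := by
        rw [integral_add hdif' hψ, integral_add (integrable_const 1) hdif, hsub]
        simp
    _ ≤ _ := by
        rw [add_comm]
        exact Real.add_one_le_exp _

/-! ### Tensorization over independent coordinates -/

theorem integral_pi_succ {E : Type*} [MeasurableSpace E] {m : ℕ} (ν : Fin (m + 1) → Measure E)
    [∀ k, IsProbabilityMeasure (ν k)] {f : (Fin (m + 1) → E) → ℝ}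
    (hf : Measurable f) {C : ℝ} (hC : ∀ y, |f y| ≤ C) :
    ∫ y, f y ∂(Measure.pi ν) =
      ∫ y, ∫ a, f (Fin.cons a y) ∂(ν 0) ∂(Measure.pi fun k : Fin m => ν k.succ) := by
  have hmp := (measurePreserving_piFinSuccAbove ν 0).symm
  rw [← hmp.integral_comp (MeasurableEquiv.measurableEmbedding _)]
  have hcons : ∀ z : E × (Fin m → E),
      (MeasurableEquiv.piFinSuccAbove (fun _ : Fin (m + 1) => E) 0).symm z = Fin.cons z.1 z.2 := by
    intro z
    simp [MeasurableEquiv.piFinSuccAbove_symm_apply, Fin.consEquiv]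
  simp only [Fin.zero_succAbove]
  rw [integral_prod_symm]
  · simp_rw [hcons]
  · exact integrable_of_abs_le (hf.comp (MeasurableEquiv.measurable _)) C fun _ => hC _

/-- Exponential moment bound for a sum of bounded functions of independent variables, in terms of
the coordinatewise oscillations `d k i`. -/
theorem integral_exp_sum_centered_le {E ι : Type*} [MeasurableSpace E] (s : Finset ι)
    {M H t : ℝ} (ht : 0 ≤ t) (m : ℕ) (ν : Fin m → Measure E) [∀ k, IsProbabilityMeasure (ν k)]
    (f : ι → (Fin m → E) → ℝ) (hf : ∀ i, Measurable (f i)) (hM : ∀ i y, |f i y| ≤ M)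
    (d : Fin m → ι → E × E → ℝ) (hd : ∀ k i, Measurable (d k i)) (hdH : ∀ k i z, d k i z ≤ H)
    (hfd : ∀ i k y a b,
      |f i (Function.update y k a) - f i (Function.update y k b)| ≤ d k i (a, b)) :
    ∫ y, Real.exp (t * ∑ i ∈ s, (f i y - ∫ y', f i y' ∂(Measure.pi ν))) ∂(Measure.pi ν) ≤
      Real.exp (∑ k, ∫ z, (Real.exp (t * ∑ i ∈ s, d k i z) - 1 - t * ∑ i ∈ s, d k i z)
        ∂((ν k).prod (ν k))) := by
  induction m with
  | zero =>
    have : ∀ i, ∫ y', f i y' ∂(Measure.pi ν) = f i (fun k => k.elim0) := by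
      intro i
      rw [Measure.pi_of_empty ν (fun k => k.elim0), integral_dirac]
    simp_rw [this]
    rw [Measure.pi_of_empty ν (fun k => k.elim0), integral_dirac]
    simp
  | succ m ih =>
    have hcons : Measurable fun z : (Fin m → E) × E => (Fin.cons z.2 z.1 : Fin (m + 1) → E) := by
      refine measurable_pi_lambda _ fun k => ?_
      refine Fin.cases ?_ (fun j => ?_) k
      · simpa using measurable_snd
      · simpa [Function.comp_def] using (measurable_pi_apply (X := fun _ : Fin m => E) j).comp
          (measurable_fst (β := E))
    have hconsl : ∀ y : Fin m → E, Measurable fun a : E => (Fin.cons a y : Fin (m + 1) → E) :=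
      fun y => hcons.comp (measurable_const.prodMk measurable_id)
    set F : ι → (Fin m → E) → ℝ := fun i y => ∫ a, f i (Fin.cons a y) ∂(ν 0) with hF
    have hFm : ∀ i, Measurable (F i) := fun i =>
      (((hf i).comp hcons).stronglyMeasurable.integral_prod_right'
        (ν := ν 0)).measurable
    have hFM : ∀ i y, |F i y| ≤ M := fun i y => abs_integral_le_of_abs_le fun a => hM i _
    have hint : ∀ i y, Integrable (fun a => f i (Fin.cons a y)) (ν 0) := fun i y =>
      integrable_of_abs_le ((hf i).comp (hconsl y)) M fun a => hM i _
    have hFint : ∀ i, ∫ y, f i y ∂(Measure.pi ν) =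
        ∫ y, F i y ∂(Measure.pi fun k : Fin m => ν k.succ) := fun i =>
      integral_pi_succ ν (hf i) (hM i)
    have hFd : ∀ i k y a b,
        |F i (Function.update y k a) - F i (Function.update y k b)| ≤ d k.succ i (a, b) := by
      intro i k y a b
      -- Averaging over coordinate 0 does not enlarge the oscillation in the other coordinates, so
      -- the induction hypothesis applies to `F`.
      rw [hF, ← integral_sub (hint i _) (hint i _)]
      refine abs_integral_le_of_abs_le fun c => ?_
      rw [Fin.cons_update, Fin.cons_update]
      exact hfd i k.succ _ a b
    have key := ih (fun k => ν k.succ) F hFm hFM (fun k => d k.succ) (fun k => hd k.succ)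
      (fun k => hdH k.succ) hFd
    set e : ι → ℝ := fun i => ∫ y, f i y ∂(Measure.pi ν) with he
    have heM : ∀ i, |e i| ≤ M := fun i => abs_integral_le_of_abs_le (hM i)
    simp_rw [← hFint] at key
    have hbound : ∀ (u v : ι → ℝ), (∀ i, |u i| ≤ M) → (∀ i, |v i| ≤ M) →
        Real.exp (t * ∑ i ∈ s, (u i - v i)) ≤ Real.exp (t * ∑ i ∈ s, (2 * M)) := by
      intro u v hu hv
      refine Real.exp_le_exp.2 (mul_le_mul_of_nonneg_left (Finset.sum_le_sum fun i _ => ?_) ht)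
      have := abs_le.1 (hu i); have := abs_le.1 (hv i); linarith
    rw [integral_pi_succ ν (f := fun y => Real.exp (t * ∑ i ∈ s, (f i y - e i))) (by fun_prop)
      (C := Real.exp (t * ∑ i ∈ s, (2 * M)))
      fun y => by rw [Real.abs_exp]; exact hbound _ _ (fun i => hM i y) heM]
    rw [Fin.sum_univ_succ, Real.exp_add]
    set c := ∫ z, (Real.exp (t * ∑ i ∈ s, d 0 i z) - 1 - t * ∑ i ∈ s, d 0 i z)
      ∂((ν 0).prod (ν 0)) with hc
    -- Split `f - e = (f - F) + (F - e)` with `y` frozen: the first part is centred in coordinate 0,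
    -- the second is constant there. The bound `d 0` does not depend on `y`, so neither does the
    -- factor `exp c`.
    have hinner : ∀ y, ∫ a, Real.exp (t * ∑ i ∈ s, (f i (Fin.cons a y) - e i)) ∂(ν 0) ≤
        Real.exp c * Real.exp (t * ∑ i ∈ s, (F i y - e i)) := by
      intro y
      have hsumint : ∫ a, ∑ i ∈ s, f i (Fin.cons a y) ∂(ν 0) = ∑ i ∈ s, F i y :=
        integral_finsetSum _ fun i _ => hint i y
      have h1 := integral_exp_centered_le (ν 0) (h := fun a => ∑ i ∈ s, f i (Fin.cons a y))
        (Finset.measurable_sum _ fun i _ => (hf i).comp (hconsl y)) (C := ∑ i ∈ s, M)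
        (fun a => (Finset.abs_sum_le_sum_abs _ _).trans (Finset.sum_le_sum fun i _ => hM i _))
        (w := fun z => ∑ i ∈ s, d 0 i z) (Finset.measurable_sum _ fun i _ => hd 0 i)
        (H := ∑ i ∈ s, H) (fun z => Finset.sum_le_sum fun i _ => hdH 0 i z)
        (fun a b => by
          rw [← Finset.sum_sub_distrib]
          refine (Finset.abs_sum_le_sum_abs _ _).trans (Finset.sum_le_sum fun i _ => ?_)
          have := hfd i 0 (Fin.cons a y) a b
          rwa [Fin.update_cons_zero, Fin.update_cons_zero] at this) ht
      rw [hsumint] at h1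
      have h2 : ∀ a, Real.exp (t * ∑ i ∈ s, (f i (Fin.cons a y) - e i)) =
          Real.exp (t * (∑ i ∈ s, f i (Fin.cons a y) - ∑ i ∈ s, F i y)) *
            Real.exp (t * ∑ i ∈ s, (F i y - e i)) := by
        intro a
        rw [← Real.exp_add, Finset.sum_sub_distrib, Finset.sum_sub_distrib]
        ring_nf
      simp_rw [h2]
      rw [integral_mul_const]
      exact mul_le_mul_of_nonneg_right h1 (Real.exp_pos _).le
    have hfe : Measurable fun y : Fin (m + 1) → E =>
        Real.exp (t * ∑ i ∈ s, (f i y - e i)) := by fun_prop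
    refine (integral_mono (integrable_of_abs_le
      ((hfe.comp hcons).stronglyMeasurable.integral_prod_right' (ν := ν 0)).measurable
        (Real.exp (t * ∑ i ∈ s, (2 * M))) fun y => abs_integral_le_of_abs_le fun a => ?_)
      (g := fun y => Real.exp c * Real.exp (t * ∑ i ∈ s, (F i y - e i)))
      ((integrable_of_abs_le (by fun_prop) (Real.exp (t * ∑ i ∈ s, (2 * M)))
        fun y => ?_).const_mul _) hinner).trans ?_
    · dsimp only [Function.comp_apply]
      rw [Real.abs_exp]; exact hbound _ _ (fun i => hM i _) heM
    · rw [Real.abs_exp]; exact hbound _ _ (fun i => hFM i y) heM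
    · rw [integral_const_mul]
      exact mul_le_mul_of_nonneg_left key (Real.exp_pos _).le

/-! ### Moments of sums with geometrically decaying second moments -/

/-- Distinct exponents bring the sum below the full geometric series, and `1 + β ≤ exp β` bounds
that. The form `exp β / β` suits `β = α / p`, where its p-th power is `exp α * (p / α) ^ p`. -/
theorem sum_exp_neg_mul_le {ι : Type*} (T : Finset ι) {e : ι → ℕ} (he : Set.InjOn e T) {β : ℝ}
    (hβ : 0 < β) : ∑ i ∈ T, Real.exp (-(β * e i)) ≤ Real.exp β / β := by
  have hr0 : 0 ≤ Real.exp (-β) := (Real.exp_pos _).le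
  have hr1 : Real.exp (-β) < 1 := by simpa using hβ
  have h1 : ∑ i ∈ T, Real.exp (-(β * e i)) = ∑ n ∈ T.image e, Real.exp (-β) ^ n := by
    rw [Finset.sum_image he]
    refine Finset.sum_congr rfl fun i _ => ?_
    rw [← Real.exp_nat_mul]
    ring_nf
  rw [h1]
  refine ((summable_geometric_of_lt_one hr0 hr1).sum_le_tsum _ fun n _ => pow_nonneg hr0 n).trans ?_
  rw [tsum_geometric_of_lt_one hr0 hr1, inv_eq_one_div,
    div_le_div_iff₀ (sub_pos.2 hr1) hβ]
  have h2 : Real.exp β * Real.exp (-β) = 1 := by rw [← Real.exp_add]; simp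
  have h3 := Real.add_one_le_exp β
  nlinarith

/-- This is Minkowski's inequality in L^(q+2), carried out by weighted convexity. The cap trades a
(q+2)-th moment for `H ^ q` times a second moment, so the norms decay like `exp (-(α / (q + 2)) * e
i)` and their sum is of order `(q + 2) / α`. -/
theorem integral_sum_pow_le {Ω ι : Type*} [MeasurableSpace Ω] (μ : Measure Ω)
    [IsProbabilityMeasure μ] (T : Finset ι) {a : ι → Ω → ℝ} (ha : ∀ i, Measurable (a i))
    (ha0 : ∀ i ω, 0 ≤ a i ω) {H : ℝ} (haH : ∀ i ω, a i ω ≤ H) (hH : 0 ≤ H) {V α : ℝ}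
    (hV : 0 ≤ V) (hα : 0 < α) {e : ι → ℕ} (he : Set.InjOn e T)
    (h2 : ∀ i ∈ T, ∫ ω, a i ω ^ 2 ∂μ ≤ V * Real.exp (-(α * e i))) (q : ℕ) :
    ∫ ω, (∑ i ∈ T, a i ω) ^ (q + 2) ∂μ ≤
      V * Real.exp α * (H ^ q * (((q + 2 : ℕ) : ℝ) / α) ^ (q + 2)) := by
  rcases T.eq_empty_or_nonempty with rfl | hT
  · simp only [Finset.sum_empty, ne_eq, Nat.add_eq_zero_iff, OfNat.ofNat_ne_zero, and_false,
      not_false_eq_true, zero_pow, integral_zero]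
    positivity
  set p : ℝ := ((q + 2 : ℕ) : ℝ) with hp
  have hp0 : 0 < p := by rw [hp]; positivity
  -- The (q+2)-th root of the second-moment decay. With weights `u i / S`, convexity costs `u i ^
  -- (-(q + 1))`, which against `u i ^ (q + 2)` leaves `u i`; the sum then reproduces `S`.
  set u : ι → ℝ := fun i => Real.exp (-(α / p * e i)) with hu
  have hu0 : ∀ i, 0 < u i := fun i => Real.exp_pos _
  have hupow : ∀ i, u i ^ (q + 2) = Real.exp (-(α * e i)) := by
    intro i
    rw [hu, ← Real.exp_nat_mul, ← hp]
    congr 1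
    field_simp
  set S := ∑ i ∈ T, u i with hS
  have hS0 : 0 < S := Finset.sum_pos (fun i _ => hu0 i) hT
  have hSle : S ^ (q + 2) ≤ Real.exp α * (p / α) ^ (q + 2) := by
    have h3 : S ≤ Real.exp (α / p) / (α / p) := sum_exp_neg_mul_le T he (by positivity)
    calc S ^ (q + 2) ≤ (Real.exp (α / p) / (α / p)) ^ (q + 2) := by gcongr
      _ = Real.exp α * (p / α) ^ (q + 2) := by
        rw [div_eq_mul_inv, inv_div, mul_pow, ← Real.exp_nat_mul, ← hp]
        congr 2
        field_simp
  have hint : ∀ i n, Integrable (fun ω => a i ω ^ n) μ := fun i n =>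
    integrable_of_abs_le ((ha i).pow_const n) (H ^ n) fun ω => by
      rw [abs_of_nonneg (pow_nonneg (ha0 i ω) n)]
      exact pow_le_pow_left₀ (ha0 i ω) (haH i ω) n
  have hpt : ∀ ω, (∑ i ∈ T, a i ω) ^ (q + 2) ≤
      ∑ i ∈ T, (S ^ (q + 1) / u i ^ (q + 1) * H ^ q) * a i ω ^ 2 := by
    intro ω
    have h4 := Real.pow_arith_mean_le_arith_mean_pow T (fun i => u i / S)
      (fun i => a i ω * S / u i) (fun i _ => div_nonneg (hu0 i).le hS0.le)
      (by rw [← Finset.sum_div, div_self hS0.ne'])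
      (fun i _ => div_nonneg (mul_nonneg (ha0 i ω) hS0.le) (hu0 i).le) (q + 2)
    have h5 : ∀ i, u i / S * (a i ω * S / u i) = a i ω := fun i => by
      have := (hu0 i).ne'
      field_simp
    simp_rw [h5] at h4
    refine h4.trans (Finset.sum_le_sum fun i _ => ?_)
    have h6 : u i / S * (a i ω * S / u i) ^ (q + 2) =
        S ^ (q + 1) / u i ^ (q + 1) * a i ω ^ q * a i ω ^ 2 := by
      have := (hu0 i).ne'
      rw [div_pow, mul_pow]
      field_simp
      ring
    rw [h6]
    have := hu0 i
    have := pow_le_pow_left₀ (ha0 i ω) (haH i ω) q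
    gcongr
  calc ∫ ω, (∑ i ∈ T, a i ω) ^ (q + 2) ∂μ
      ≤ ∫ ω, ∑ i ∈ T, (S ^ (q + 1) / u i ^ (q + 1) * H ^ q) * a i ω ^ 2 ∂μ :=
        integral_mono_of_nonneg
          (ae_of_all _ fun ω => pow_nonneg (Finset.sum_nonneg fun i _ => ha0 i ω) _)
          (integrable_finsetSum _ fun i _ => (hint i 2).const_mul _) (ae_of_all _ hpt)
    _ = ∑ i ∈ T, (S ^ (q + 1) / u i ^ (q + 1) * H ^ q) * ∫ ω, a i ω ^ 2 ∂μ := by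
        rw [integral_finsetSum _ fun i _ => (hint i 2).const_mul _]
        simp_rw [integral_const_mul]
    _ ≤ ∑ i ∈ T, (S ^ (q + 1) / u i ^ (q + 1) * H ^ q) * (V * u i ^ (q + 2)) := by
        refine Finset.sum_le_sum fun i hi => ?_
        rw [hupow]
        have := hu0 i
        exact mul_le_mul_of_nonneg_left (h2 i hi) (by positivity)
    _ = ∑ i ∈ T, (S ^ (q + 1) * H ^ q * V) * u i := by
        refine Finset.sum_congr rfl fun i _ => ?_
        have := (hu0 i).ne'
        field_simp
        ring
    _ = V * H ^ q * S ^ (q + 2) := by rw [← Finset.mul_sum, ← hS]; ring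
    _ ≤ V * H ^ q * (Real.exp α * (p / α) ^ (q + 2)) := by gcongr
    _ = _ := by ring

theorem hasSum_exp_sub_one_sub (u : ℝ) :
    HasSum (fun q : ℕ => u ^ (q + 2) / ((q + 2).factorial : ℝ)) (Real.exp u - 1 - u) := by
  have h := (hasSum_nat_add_iff' 2).2 (NormedSpace.expSeries_div_hasSum_exp (𝔸 := ℝ) u)
  rw [← Real.exp_eq_exp_ℝ] at h
  simpa [Finset.sum_range_succ, sub_sub] using h

/-- Bernstein-type bound for the exponential remainder from the growth of moments. -/
theorem integral_exp_sub_one_sub_le {Ω : Type*} [MeasurableSpace Ω] (μ : Measure Ω)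
    [IsProbabilityMeasure μ] {W : Ω → ℝ} (hW : Measurable W) (hW0 : ∀ ω, 0 ≤ W ω) {C : ℝ}
    (hWC : ∀ ω, W ω ≤ C) {K H α t : ℝ} (hH : 0 ≤ H) (hK : 0 ≤ K) (hα : 0 < α) (ht : 0 ≤ t)
    (hmom : ∀ q : ℕ, ∫ ω, W ω ^ (q + 2) ∂μ ≤
      K * (H ^ q * (((q + 2 : ℕ) : ℝ) / α) ^ (q + 2)))
    (hlt : t * (H * Real.exp 1 / α) < 1) :
    ∫ ω, (Real.exp (t * W ω) - 1 - t * W ω) ∂μ ≤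
      K * (Real.exp 1 / α) ^ 2 * (t ^ 2 / (1 - t * (H * Real.exp 1 / α))) := by
  set r := t * (H * Real.exp 1 / α) with hr
  have hr0 : 0 ≤ r := by positivity
  set F : ℕ → Ω → ℝ := fun q ω => (t * W ω) ^ (q + 2) / ((q + 2).factorial : ℝ) with hF
  have hF0 : ∀ q ω, 0 ≤ F q ω := fun q ω =>
    div_nonneg (pow_nonneg (mul_nonneg ht (hW0 ω)) _) (Nat.cast_nonneg _)
  have hFint : ∀ q, Integrable (F q) μ := fun q =>
    integrable_of_abs_le (by fun_prop) ((t * C) ^ (q + 2) / ((q + 2).factorial : ℝ)) fun ω => by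
      rw [abs_of_nonneg (hF0 q ω)]
      have := hW0 ω
      have := hWC ω
      simp only [hF]
      gcongr
  have hFle : ∀ q, ∫ ω, F q ω ∂μ ≤ K * (Real.exp 1 / α) ^ 2 * t ^ 2 * r ^ q := by
    intro q
    have h1 : ∫ ω, F q ω ∂μ =
        t ^ (q + 2) / ((q + 2).factorial : ℝ) * ∫ ω, W ω ^ (q + 2) ∂μ := by
      rw [← integral_const_mul]
      refine integral_congr_ae (ae_of_all _ fun ω => ?_)
      simp only [hF]
      ring
    rw [h1]
    -- The bound `m ^ m / m! ≤ exp m`, a single term of the exponential series, cancels the moment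
    -- growth and leaves a geometric series of ratio `r`.
    have h2 : ((q + 2 : ℕ) : ℝ) ^ (q + 2) / ((q + 2).factorial : ℝ) ≤
        Real.exp 1 ^ (q + 2) := by
      refine (Real.pow_div_factorial_le_exp _ (Nat.cast_nonneg _) _).trans_eq ?_
      rw [← Real.exp_nat_mul, mul_one]
    calc t ^ (q + 2) / ((q + 2).factorial : ℝ) * ∫ ω, W ω ^ (q + 2) ∂μ
        ≤ t ^ (q + 2) / ((q + 2).factorial : ℝ) *
          (K * (H ^ q * (((q + 2 : ℕ) : ℝ) / α) ^ (q + 2))) :=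
          mul_le_mul_of_nonneg_left (hmom q) (by positivity)
      _ = K * t ^ (q + 2) * H ^ q / α ^ (q + 2) *
          (((q + 2 : ℕ) : ℝ) ^ (q + 2) / ((q + 2).factorial : ℝ)) := by
          rw [div_pow]; ring
      _ ≤ K * t ^ (q + 2) * H ^ q / α ^ (q + 2) * Real.exp 1 ^ (q + 2) := by gcongr
      _ = _ := by rw [hr, mul_pow, div_pow, div_pow, mul_pow]; field_simp; ring
  have hgeo : HasSum (fun q => K * (Real.exp 1 / α) ^ 2 * t ^ 2 * r ^ q)
      (K * (Real.exp 1 / α) ^ 2 * t ^ 2 * (1 - r)⁻¹) :=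
    (hasSum_geometric_of_lt_one hr0 hlt).mul_left _
  have hnorm : ∀ q, ∫ ω, ‖F q ω‖ ∂μ = ∫ ω, F q ω ∂μ := fun q =>
    integral_congr_ae (ae_of_all _ fun ω => Real.norm_of_nonneg (hF0 q ω))
  have hsum := hasSum_integral_of_summable_integral_norm hFint
    (by
      simp_rw [hnorm]
      exact Summable.of_nonneg_of_le (fun q => integral_nonneg (hF0 q)) hFle hgeo.summable)
  have htsum : ∀ ω, ∑' q, F q ω = Real.exp (t * W ω) - 1 - t * W ω := fun ω =>
    (hasSum_exp_sub_one_sub _).tsum_eq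
  simp_rw [htsum] at hsum
  refine (hasSum_le hFle hsum hgeo).trans_eq ?_
  rw [div_eq_mul_inv]
  ring

/-! ### Spectral norm, white noise and independence of the innovation vectors -/

/-- Apply `A` to its own j-th row `r`: the j-th coordinate of the image is `‖r‖ ^ 2`, and it is at
most `‖A‖ * ‖r‖`. -/
theorem sum_row_sq_le_matSpectralNorm_sq {p : ℕ} (A : Matrix (Fin p) (Fin p) ℝ) (j : Fin p) :
    ∑ l, A j l ^ 2 ≤ matSpectralNorm A ^ 2 := by
  set r : EuclideanSpace ℝ (Fin p) := WithLp.toLp 2 (A j) with hr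
  have hn : ‖r‖ ^ 2 = ∑ l, A j l ^ 2 := by
    rw [EuclideanSpace.norm_sq_eq]
    simp [hr]
  have hj : (Matrix.toEuclideanCLM (n := Fin p) (𝕜 := ℝ) A r) j = ‖r‖ ^ 2 := by
    rw [hn]
    simp [hr, Matrix.mulVec, dotProduct, sq]
  have h1 : ‖r‖ ^ 2 ≤ matSpectralNorm A * ‖r‖ := by
    rw [← hj]
    exact (le_abs_self _).trans ((PiLp.norm_apply_le _ j).trans
      ((Matrix.toEuclideanCLM (n := Fin p) (𝕜 := ℝ) A).le_opNorm r))
  rw [← hn]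
  have hA : 0 ≤ matSpectralNorm A := norm_nonneg _
  rcases (norm_nonneg r).eq_or_lt with h0 | h0
  · rw [← h0, zero_pow two_ne_zero]
    exact sq_nonneg _
  · have : ‖r‖ ≤ matSpectralNorm A := by nlinarith
    gcongr

/-- The law of a random vector with uncorrelated centred coordinates of variance `σ ^ 2`, expressed
through its linear functionals. -/
structure IsWhiteNoiseLaw {p : ℕ} (σ : ℝ) (ν : Measure (Fin p → ℝ)) : Prop where
  integrable : ∀ c : Fin p → ℝ, Integrable (fun y => c ⬝ᵥ y) ν
  integrable_sq : ∀ c : Fin p → ℝ, Integrable (fun y => (c ⬝ᵥ y) ^ 2) ν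
  integral_eq_zero : ∀ c : Fin p → ℝ, ∫ y, c ⬝ᵥ y ∂ν = 0
  integral_sq : ∀ c : Fin p → ℝ, ∫ y, (c ⬝ᵥ y) ^ 2 ∂ν = σ ^ 2 * ∑ l, c l ^ 2

theorem measurable_dotProduct_left {p : ℕ} (c : Fin p → ℝ) :
    Measurable fun y : Fin p → ℝ => c ⬝ᵥ y := by
  unfold dotProduct
  fun_prop

theorem IsIIDInnovation.isWhiteNoiseLaw {Ω : Type*} [MeasurableSpace Ω] {P : Measure Ω}
    [IsProbabilityMeasure P] {p : ℕ} {σ : ℝ} {ε : ℤ → Fin p → Ω → ℝ} (h : IsIIDInnovation P σ ε)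
    (i : ℤ) : IsWhiteNoiseLaw σ (P.map fun ω j => ε i j ω) := by
  have hm : Measurable fun ω j => ε i j ω := measurable_pi_lambda _ fun j => h.measurable i j
  have hL2 : ∀ c : Fin p → ℝ, MemLp (fun ω => c ⬝ᵥ fun j => ε i j ω) 2 P := fun c =>
    memLp_finsetSum _ fun j _ => (h.memLp_two i j).const_mul (c j)
  have h0 : ∀ c : Fin p → ℝ, ∫ ω, (c ⬝ᵥ fun j => ε i j ω) ∂P = 0 := by
    intro c
    simp only [dotProduct]
    rw [integral_finsetSum _ fun j _ =>
      ((h.memLp_two i j).integrable one_le_two).const_mul (c j)]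
    simp [integral_const_mul, h.mean_zero]
  have hvar : ∀ c : Fin p → ℝ,
      ∫ ω, (c ⬝ᵥ fun j => ε i j ω) ^ 2 ∂P = σ ^ 2 * ∑ l, c l ^ 2 := by
    intro c
    have h1 : Var[∑ j, fun ω => c j * ε i j ω; P] = ∑ j, Var[fun ω => c j * ε i j ω; P] := by
      refine IndepFun.variance_sum (fun j _ => (h.memLp_two i j).const_mul (c j)) ?_
      intro j _ k _ hjk
      have h2 : ε i j ⟂ᵢ[P] ε i k :=
        h.indep.indepFun (i := (i, j)) (j := (i, k)) fun he => hjk (Prod.mk.inj he).2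
      exact h2.comp (φ := fun x => c j * x) (ψ := fun x => c k * x) (by fun_prop) (by fun_prop)
    have h3 : (∑ j, fun ω => c j * ε i j ω) = fun ω => c ⬝ᵥ fun j => ε i j ω := by
      ext ω
      simp [dotProduct]
    rw [h3, variance_of_integral_eq_zero (hL2 c).aemeasurable (h0 c)] at h1
    rw [h1, Finset.mul_sum]
    refine Finset.sum_congr rfl fun j _ => ?_
    rw [variance_const_mul, variance_of_integral_eq_zero (h.measurable i j).aemeasurable
      (h.mean_zero i j), h.second_moment]
    ring
  refine ⟨fun c => ?_, fun c => ?_, fun c => ?_, fun c => ?_⟩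
  · rw [integrable_map_measure (measurable_dotProduct_left c).aestronglyMeasurable hm.aemeasurable]
    exact (hL2 c).integrable one_le_two
  · rw [integrable_map_measure ((measurable_dotProduct_left c).pow_const 2).aestronglyMeasurable
      hm.aemeasurable]
    exact (hL2 c).integrable_sq
  · rw [integral_map hm.aemeasurable (measurable_dotProduct_left c).aestronglyMeasurable]
    exact h0 c
  · rw [integral_map hm.aemeasurable
      ((measurable_dotProduct_left c).pow_const 2).aestronglyMeasurable]
    exact hvar c

theorem IsWhiteNoiseLaw.integrable_sub_sq {p : ℕ} {σ : ℝ} {ν : Measure (Fin p → ℝ)}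
    [IsProbabilityMeasure ν] (h : IsWhiteNoiseLaw σ ν) (c : Fin p → ℝ) :
    Integrable (fun z : (Fin p → ℝ) × (Fin p → ℝ) => (c ⬝ᵥ (z.1 - z.2)) ^ 2) (ν.prod ν) ∧
      ∫ z, (c ⬝ᵥ (z.1 - z.2)) ^ 2 ∂(ν.prod ν) = 2 * σ ^ 2 * ∑ l, c l ^ 2 := by
  have hexp : ∀ z : (Fin p → ℝ) × (Fin p → ℝ), (c ⬝ᵥ (z.1 - z.2)) ^ 2 =
      (c ⬝ᵥ z.1) ^ 2 + (c ⬝ᵥ z.2) ^ 2 - 2 * ((c ⬝ᵥ z.1) * (c ⬝ᵥ z.2)) := by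
    intro z
    rw [dotProduct_sub]
    ring
  have i1 : Integrable (fun z : (Fin p → ℝ) × (Fin p → ℝ) => (c ⬝ᵥ z.1) ^ 2) (ν.prod ν) :=
    (h.integrable_sq c).comp_fst ν
  have i2 : Integrable (fun z : (Fin p → ℝ) × (Fin p → ℝ) => (c ⬝ᵥ z.2) ^ 2) (ν.prod ν) :=
    (h.integrable_sq c).comp_snd ν
  have i3 : Integrable (fun z : (Fin p → ℝ) × (Fin p → ℝ) => 2 * ((c ⬝ᵥ z.1) * (c ⬝ᵥ z.2)))
      (ν.prod ν) := ((h.integrable c).mul_prod (h.integrable c)).const_mul 2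
  have i12 : Integrable (fun z : (Fin p → ℝ) × (Fin p → ℝ) => (c ⬝ᵥ z.1) ^ 2 + (c ⬝ᵥ z.2) ^ 2)
      (ν.prod ν) := i1.add i2
  simp_rw [hexp]
  refine ⟨i12.sub i3, ?_⟩
  rw [integral_sub i12 i3, integral_add i1 i2, integral_const_mul,
    integral_prod_mul (fun y => c ⬝ᵥ y) (fun y => c ⬝ᵥ y),
    integral_fun_fst (μ := ν) (ν := ν) (fun y => (c ⬝ᵥ y) ^ 2),
    integral_fun_snd (μ := ν) (ν := ν) (fun y => (c ⬝ᵥ y) ^ 2), h.integral_eq_zero, h.integral_sq]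
  simp
  ring

/-- The effect on a `g`-weighted Lipschitz function of replacing one innovation, filtered by `A`. -/
def weightedGap {p : ℕ} (g : Fin p → ℝ) (A : Matrix (Fin p) (Fin p) ℝ)
    (z : (Fin p → ℝ) × (Fin p → ℝ)) : ℝ :=
  ∑ j, g j * |A.mulVec (z.1 - z.2) j|

theorem measurable_weightedGap {p : ℕ} (g : Fin p → ℝ) (A : Matrix (Fin p) (Fin p) ℝ) :
    Measurable (weightedGap g A) := by
  unfold weightedGap Matrix.mulVec dotProduct
  simp only [Pi.sub_apply]
  fun_prop

theorem weightedGap_nonneg {p : ℕ} {g : Fin p → ℝ} (hg : ∀ j, 0 ≤ g j)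
    (A : Matrix (Fin p) (Fin p) ℝ) (z : (Fin p → ℝ) × (Fin p → ℝ)) : 0 ≤ weightedGap g A z :=
  Finset.sum_nonneg fun j _ => mul_nonneg (hg j) (abs_nonneg _)

/-- Since the weights sum to one, Jensen moves the square inside the sum over coordinates. Each
coordinate then involves one row of `A`, so no factor of the dimension appears; the 2 is the
variance doubling of a difference of independent copies. -/
theorem IsWhiteNoiseLaw.integral_min_weightedGap_sq_le {p : ℕ} {σ : ℝ} {ν : Measure (Fin p → ℝ)}
    [IsProbabilityMeasure ν] (h : IsWhiteNoiseLaw σ ν) {g : Fin p → ℝ} (hg : ∀ j, 0 ≤ g j)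
    (hg_sum : ∑ j, g j = 1) (A : Matrix (Fin p) (Fin p) ℝ) {H : ℝ} (hH : 0 ≤ H) :
    ∫ z, min H (weightedGap g A z) ^ 2 ∂(ν.prod ν) ≤ 2 * σ ^ 2 * matSpectralNorm A ^ 2 := by
  have hpt : ∀ z, min H (weightedGap g A z) ^ 2 ≤ ∑ j, g j * (A j ⬝ᵥ (z.1 - z.2)) ^ 2 := by
    intro z
    refine (pow_le_pow_left₀ (le_min hH (weightedGap_nonneg hg A z)) (min_le_right _ _) 2).trans ?_
    have := Real.pow_arith_mean_le_arith_mean_pow Finset.univ g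
      (fun j => |A.mulVec (z.1 - z.2) j|) (fun j _ => hg j) hg_sum (fun j _ => abs_nonneg _) 2
    simp only [sq_abs] at this
    exact this
  calc ∫ z, min H (weightedGap g A z) ^ 2 ∂(ν.prod ν)
      ≤ ∫ z, ∑ j, g j * (A j ⬝ᵥ (z.1 - z.2)) ^ 2 ∂(ν.prod ν) :=
        integral_mono_of_nonneg (ae_of_all _ fun z => sq_nonneg _)
          (integrable_finsetSum _ fun j _ => (h.integrable_sub_sq (A j)).1.const_mul (g j))
          (ae_of_all _ hpt)
    _ = ∑ j, g j * (2 * σ ^ 2 * ∑ l, A j l ^ 2) := by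
        rw [integral_finsetSum _ fun j _ => (h.integrable_sub_sq (A j)).1.const_mul (g j)]
        simp_rw [integral_const_mul, (h.integrable_sub_sq _).2]
    _ ≤ ∑ j, g j * (2 * σ ^ 2 * matSpectralNorm A ^ 2) := by
        refine Finset.sum_le_sum fun j _ => mul_le_mul_of_nonneg_left ?_ (hg j)
        exact mul_le_mul_of_nonneg_left (sum_row_sq_le_matSpectralNorm_sq A j) (by positivity)
    _ = _ := by rw [← Finset.sum_mul, hg_sum, one_mul]

/-- Independence of a doubly indexed family gives independence of its rows. -/
theorem iIndepFun_rows {Ω ι κ : Type*} [MeasurableSpace Ω] {P : Measure Ω} [IsProbabilityMeasure P]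
    {X : ι → κ → Ω → ℝ} (mX : ∀ i j, Measurable (X i j))
    (h : iIndepFun (fun a : ι × κ => X a.1 a.2) P) : iIndepFun (fun i ω j => X i j ω) P := by
  have hs : iIndepFun (fun (a : (_ : ι) × κ) ω => X a.1 a.2 ω) P :=
    h.precomp (g := Equiv.sigmaEquivProd ι κ) (Equiv.injective _)
  have hprob : ∀ i j, IsProbabilityMeasure (P.map (X i j)) :=
    fun i j => Measure.isProbabilityMeasure_map (mX i j).aemeasurable
  rw [iIndepFun_iff_map_fun_eq_infinitePi_map (by fun_prop)] at hs ⊢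
  have hrow : ∀ i, P.map (fun ω j => X i j ω) = Measure.infinitePi fun j => P.map (X i j) :=
    fun i => iIndepFun.map_fun_eq_infinitePi_map (mX i)
      (h.precomp (g := fun j => (i, j)) fun a b hab => (Prod.mk.inj hab).2)
  simp_rw [hrow]
  rw [← Measure.infinitePi_map_piCurry (fun i j => P.map (X i j)), ← hs,
    Measure.map_map (by fun_prop) (by fun_prop)]
  rfl

/-! ### Contributions of the innovations and the truncated process -/

/-- The natural-number difference `k + 1 - n` is the smallest lag from the innovation at time `n -
k` to the sample. It vanishes for the `n` innovations inside the sample; the others form a geometric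
tail. -/
theorem sum_exp_neg_mul_sub_le (n K : ℕ) {α : ℝ} (hα : 0 < α) :
    ∑ k ∈ Finset.range K, Real.exp (-(α * ((k + 1 - n : ℕ) : ℝ))) ≤ n + 1 / α := by
  calc ∑ k ∈ Finset.range K, Real.exp (-(α * ((k + 1 - n : ℕ) : ℝ)))
      ≤ ∑ k ∈ Finset.range (n + K), Real.exp (-(α * ((k + 1 - n : ℕ) : ℝ))) :=
        Finset.sum_le_sum_of_subset_of_nonneg (Finset.range_mono (Nat.le_add_left K n))
          fun _ _ _ => (Real.exp_pos _).le
    _ = ∑ k ∈ Finset.range n, Real.exp (-(α * ((k + 1 - n : ℕ) : ℝ))) +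
        ∑ j ∈ Finset.range K, Real.exp (-(α * ((n + j + 1 - n : ℕ) : ℝ))) :=
        Finset.sum_range_add _ n K
    _ ≤ ∑ _k ∈ Finset.range n, (1 : ℝ) + 1 / α := by
        refine add_le_add (Finset.sum_le_sum fun k _ => ?_) ?_
        · rw [Real.exp_le_one_iff]
          exact neg_nonpos.2 (by positivity)
        · have h1 : ∀ j : ℕ, Real.exp (-(α * ((n + j + 1 - n : ℕ) : ℝ))) =
              Real.exp (-α) * Real.exp (-(α * ((id j : ℕ) : ℝ))) := by
            intro j
            rw [← Real.exp_add, show n + j + 1 - n = j + 1 by omega]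
            push_cast
            simp only [id]
            ring_nf
          simp_rw [h1]
          rw [← Finset.mul_sum]
          calc Real.exp (-α) * ∑ j ∈ Finset.range K, Real.exp (-(α * ((id j : ℕ) : ℝ)))
              ≤ Real.exp (-α) * (Real.exp α / α) :=
                mul_le_mul_of_nonneg_left
                  (sum_exp_neg_mul_le (Finset.range K) (e := id) Function.injective_id.injOn hα)
                  (Real.exp_pos _).le
            _ = 1 / α := by rw [← mul_div_assoc, ← Real.exp_add]; simp
    _ = n + 1 / α := by simp

/-- Contribution of the innovation at lag `k` behind the end of the sample. -/
theorem integral_exp_weightedGap_le {p : ℕ} {σ : ℝ} {ν : Measure (Fin p → ℝ)}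
    [IsProbabilityMeasure ν] (h : IsWhiteNoiseLaw σ ν) {g : Fin p → ℝ} (hg : ∀ j, 0 ≤ g j)
    (hg_sum : ∑ j, g j = 1) {A : ℕ → Matrix (Fin p) (Fin p) ℝ} {γ α H t : ℝ} (hH : 0 ≤ H)
    (hα : 0 < α) (ht : 0 ≤ t) (hA : ∀ k : ℕ, matSpectralNorm (A k) ^ 2 ≤
      γ ^ 2 * Real.exp (-(α * k))) (hlt : t * (H * Real.exp 1 / α) < 1) (n k : ℕ) :
    ∫ z, (Real.exp (t * ∑ i ∈ Finset.range n,
          if i ≤ k then min H (weightedGap g (A (k - i)) z) else 0) - 1 -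
        t * ∑ i ∈ Finset.range n,
          if i ≤ k then min H (weightedGap g (A (k - i)) z) else 0) ∂(ν.prod ν) ≤
      (2 * σ ^ 2 * γ ^ 2 * Real.exp (-(α * ((k + 1 - n : ℕ) : ℝ)))) * Real.exp α *
        (Real.exp 1 / α) ^ 2 * (t ^ 2 / (1 - t * (H * Real.exp 1 / α))) := by
  simp_rw [← Finset.sum_filter]
  set T := (Finset.range n).filter (· ≤ k) with hT
  have hmem : ∀ i ∈ T, i < n ∧ i ≤ k := fun i hi => by simpa [hT] using hi
  have hm : ∀ i, Measurable fun z => min H (weightedGap g (A (k - i)) z) := fun i =>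
    measurable_const.min (measurable_weightedGap g _)
  have h0 : ∀ i z, 0 ≤ min H (weightedGap g (A (k - i)) z) := fun i z =>
    le_min hH (weightedGap_nonneg hg _ z)
  -- The exponent `e` is the excess of the lag `k - i` over its minimum `k + 1 - n`; the decay at
  -- the minimal lag is put into the variance factor.
  refine integral_exp_sub_one_sub_le (ν.prod ν) (Finset.measurable_sum _ fun i _ => hm i)
    (fun z => Finset.sum_nonneg fun i _ => h0 i z) (C := ∑ i ∈ T, H)
    (fun z => Finset.sum_le_sum fun i _ => min_le_left _ _) hH (by positivity) hα ht
    (fun q => integral_sum_pow_le (ν.prod ν) T hm h0 (fun i z => min_le_left _ _) hH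
      (by positivity) hα (e := fun i => k - i - (k + 1 - n)) ?_ (fun i hi => ?_) q) hlt
  · intro i hi j hj hij
    have := hmem i hi
    have := hmem j hj
    simp only at hij
    omega
  · refine (h.integral_min_weightedGap_sq_le hg hg_sum _ hH).trans ?_
    have h1 := hmem i hi
    have h2 : ((k - i : ℕ) : ℝ) = ((k + 1 - n : ℕ) : ℝ) + ((k - i - (k + 1 - n) : ℕ) : ℝ) := by
      rw [← Nat.cast_add]
      congr 1
      omega
    calc 2 * σ ^ 2 * matSpectralNorm (A (k - i)) ^ 2
        ≤ 2 * σ ^ 2 * (γ ^ 2 * Real.exp (-(α * ((k - i : ℕ) : ℝ)))) :=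
          mul_le_mul_of_nonneg_left (hA _) (by positivity)
      _ = _ := by
          rw [h2, mul_add, neg_add, Real.exp_add]
          ring

/-- The linear process at time `n - i`, driven only by the innovations `y k` at times `n - k`,
`k < K`. -/
def truncatedProcess {p K : ℕ} (μ : Fin p → ℝ) (A : ℕ → Matrix (Fin p) (Fin p) ℝ) (i : ℕ)
    (y : Fin K → Fin p → ℝ) : Fin p → ℝ :=
  μ + ∑ k : Fin K, if i ≤ k then (A (k - i)).mulVec (y k) else 0

theorem measurable_truncatedProcess {p K : ℕ} (μ : Fin p → ℝ)
    (A : ℕ → Matrix (Fin p) (Fin p) ℝ) (i : ℕ) :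
    Measurable (truncatedProcess (K := K) μ A i) := by
  unfold truncatedProcess Matrix.mulVec dotProduct
  refine measurable_const.add (Finset.measurable_sum _ fun k _ => ?_)
  split_ifs
  · fun_prop
  · exact measurable_const

theorem truncatedProcess_update_sub {p K : ℕ} (μ : Fin p → ℝ)
    (A : ℕ → Matrix (Fin p) (Fin p) ℝ) (i : ℕ) (k : Fin K) (y : Fin K → Fin p → ℝ)
    (a b : Fin p → ℝ) :
    truncatedProcess μ A i (Function.update y k a) -
      truncatedProcess μ A i (Function.update y k b) =
      if i ≤ k then (A (k - i)).mulVec (a - b) else 0 := by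
  unfold truncatedProcess
  rw [add_sub_add_left_eq_sub, ← Finset.sum_sub_distrib, Finset.sum_eq_single k]
  · split_ifs
    · simp [Matrix.mulVec_sub]
    · simp
  · intro l _ hl
    simp [Function.update_of_ne hl]
  · simp

theorem continuous_of_weighted_lipschitz {p : ℕ} {G : (Fin p → ℝ) → ℝ} {g : Fin p → ℝ}
    (hg : ∀ j, 0 ≤ g j) (hg_sum : ∑ j, g j = 1)
    (hGLip : ∀ u v : Fin p → ℝ, |G u - G v| ≤ ∑ j, g j * |u j - v j|) : Continuous G := by
  refine (LipschitzWith.of_dist_le_mul (K := 1) fun u v => ?_).continuous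
  rw [Real.dist_eq, NNReal.coe_one, one_mul]
  calc |G u - G v| ≤ ∑ j, g j * |u j - v j| := hGLip u v
    _ ≤ ∑ j, g j * dist u v := Finset.sum_le_sum fun j _ =>
        mul_le_mul_of_nonneg_left (dist_le_pi_dist u v j) (hg j)
    _ = dist u v := by rw [← Finset.sum_mul, hg_sum, one_mul]

/-- The bound is uniform in the number `K` of innovations, which is what permits the later limit. -/
theorem integral_exp_truncatedProcess_le {p n K : ℕ} {σ : ℝ} (ν : Fin K → Measure (Fin p → ℝ))
    [∀ k, IsProbabilityMeasure (ν k)] (h : ∀ k, IsWhiteNoiseLaw σ (ν k)) (μ : Fin p → ℝ)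
    {A : ℕ → Matrix (Fin p) (Fin p) ℝ} {γ α M t : ℝ} (hα : 0 < α) (ht : 0 ≤ t)
    (hA : ∀ k : ℕ, matSpectralNorm (A k) ^ 2 ≤ γ ^ 2 * Real.exp (-(α * k)))
    {G : (Fin p → ℝ) → ℝ} (hGM : ∀ u, |G u| ≤ M)
    {g : Fin p → ℝ} (hg : ∀ j, 0 ≤ g j) (hg_sum : ∑ j, g j = 1)
    (hGLip : ∀ u v : Fin p → ℝ, |G u - G v| ≤ ∑ j, g j * |u j - v j|)
    (hlt : t * (2 * M * Real.exp 1 / α) < 1) :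
    ∫ y, Real.exp (t * ∑ i ∈ Finset.range n, (G (truncatedProcess μ A i y) -
        ∫ y', G (truncatedProcess μ A i y') ∂(Measure.pi ν))) ∂(Measure.pi ν) ≤
      Real.exp (2 * σ ^ 2 * γ ^ 2 * Real.exp α * (Real.exp 1 / α) ^ 2 * (n + 1 / α) *
        (t ^ 2 / (1 - t * (2 * M * Real.exp 1 / α)))) := by
  have hM : 0 ≤ 2 * M := by
    have := (abs_nonneg _).trans (hGM 0)
    linarith
  have hGm : Measurable G := (continuous_of_weighted_lipschitz hg hg_sum hGLip).measurable
  refine (integral_exp_sum_centered_le (Finset.range n) (M := M) (H := 2 * M) ht K ν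
    (fun i y => G (truncatedProcess μ A i y))
    (fun i => hGm.comp (measurable_truncatedProcess μ A i)) (fun i y => hGM _)
    (fun k i z => if i ≤ k then min (2 * M) (weightedGap g (A (k - i)) z) else 0)
    (fun k i => ?_) (fun k i z => ?_) (fun i k y a b => ?_)).trans (Real.exp_le_exp.2 ?_)
  · split_ifs
    · exact measurable_const.min (measurable_weightedGap g _)
    · exact measurable_const
  · split_ifs
    · exact min_le_left _ _
    · exact hM
  · have hd := truncatedProcess_update_sub μ A i k y a b
    have hL := hGLip (truncatedProcess μ A i (Function.update y k a))
      (truncatedProcess μ A i (Function.update y k b))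
    simp only [← Pi.sub_apply] at hL
    rw [hd] at hL
    split_ifs at hL ⊢ with hik
    · refine le_min ?_ hL
      have h1 := abs_le.1 (hGM (truncatedProcess μ A i (Function.update y k a)))
      have h2 := abs_le.1 (hGM (truncatedProcess μ A i (Function.update y k b)))
      exact abs_le.2 ⟨by linarith, by linarith⟩
    · simpa using hL
  · refine (Finset.sum_le_sum fun k _ =>
      integral_exp_weightedGap_le (h k) hg hg_sum hM hα ht hA hlt n k).trans ?_
    have h1 := sum_exp_neg_mul_sub_le n K hα
    rw [← Fin.sum_univ_eq_sum_range
      (fun k : ℕ => Real.exp (-(α * ((k + 1 - n : ℕ) : ℝ)))) K] at h1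
    have h2 : 0 ≤ t ^ 2 / (1 - t * (2 * M * Real.exp 1 / α)) :=
      div_nonneg (sq_nonneg t) (sub_nonneg.2 hlt.le)
    rw [← Finset.sum_mul, ← Finset.sum_mul, ← Finset.sum_mul, ← Finset.mul_sum]
    refine mul_le_mul_of_nonneg_right ?_ h2
    calc _ ≤ 2 * σ ^ 2 * γ ^ 2 * (n + 1 / α) * Real.exp α * (Real.exp 1 / α) ^ 2 := by gcongr
      _ = _ := by ring

/-! ### Passage to the full linear process -/

/-- Identifies the truncation with a partial sum of the defining series, of length `K - i`; for
fixed `i` this length tends to infinity with `K`. -/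
theorem truncatedProcess_innovations {p K : ℕ} (μ : Fin p → ℝ)
    (A : ℕ → Matrix (Fin p) (Fin p) ℝ) (e : ℤ → Fin p → ℝ) (n i : ℕ) :
    truncatedProcess μ A i (fun k : Fin K => e ((n : ℤ) - (k : ℕ))) =
      μ + ∑ l ∈ Finset.range (K - i), (A l).mulVec (e ((n : ℤ) - i - (l : ℤ))) := by
  unfold truncatedProcess
  congr 1
  rw [Fin.sum_univ_eq_sum_range
    (fun k : ℕ => if i ≤ k then (A (k - i)).mulVec (e ((n : ℤ) - (k : ℤ))) else 0) K,
    ← Finset.sum_filter]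
  have h1 : (Finset.range K).filter (fun k => i ≤ k) = Finset.Ico i K := by
    ext k
    simp only [Finset.mem_filter, Finset.mem_range, Finset.mem_Ico]
    omega
  rw [h1, Finset.sum_Ico_eq_sum_range]
  refine Finset.sum_congr rfl fun l _ => ?_
  rw [Nat.add_sub_cancel_left, Nat.cast_add, sub_add_eq_sub_sub]

/-- As `K` grows, continuity of `G` gives almost sure convergence, and `|G| ≤ M` dominates both the
inner means and the exponentials. -/
theorem integral_exp_linearProcess_le {Ω : Type*} [MeasurableSpace Ω] {P : Measure Ω}
    [IsProbabilityMeasure P] {p n : ℕ} {μ : Fin p → ℝ} {A : ℕ → Matrix (Fin p) (Fin p) ℝ}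
    {ε : ℤ → Fin p → Ω → ℝ} {X : ℤ → Ω → Fin p → ℝ} {σ γ α M t : ℝ}
    (hε : IsIIDInnovation P σ ε) (hX : IsLinearProcess P μ A ε X) (hα : 0 < α) (ht : 0 ≤ t)
    (hA : ∀ k : ℕ, matSpectralNorm (A k) ^ 2 ≤ γ ^ 2 * Real.exp (-(α * k)))
    {G : (Fin p → ℝ) → ℝ} (hGM : ∀ u, |G u| ≤ M)
    {g : Fin p → ℝ} (hg : ∀ j, 0 ≤ g j) (hg_sum : ∑ j, g j = 1)
    (hGLip : ∀ u v : Fin p → ℝ, |G u - G v| ≤ ∑ j, g j * |u j - v j|)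
    (hlt : t * (2 * M * Real.exp 1 / α) < 1) :
    Integrable (fun ω => Real.exp (t * ∑ i ∈ Finset.range n,
        (G (X ((n : ℤ) - i) ω) - ∫ ω', G (X ((n : ℤ) - i) ω') ∂P))) P ∧
    ∫ ω, Real.exp (t * ∑ i ∈ Finset.range n,
        (G (X ((n : ℤ) - i) ω) - ∫ ω', G (X ((n : ℤ) - i) ω') ∂P)) ∂P ≤
      Real.exp (2 * σ ^ 2 * γ ^ 2 * Real.exp α * (Real.exp 1 / α) ^ 2 * (n + 1 / α) *
        (t ^ 2 / (1 - t * (2 * M * Real.exp 1 / α)))) := by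
  have hGc : Continuous G := continuous_of_weighted_lipschitz hg hg_sum hGLip
  have hεm : ∀ i, Measurable fun ω j => ε i j ω := fun i =>
    measurable_pi_lambda _ fun j => hε.measurable i j
  let Y : ∀ K : ℕ, Ω → Fin K → Fin p → ℝ := fun K ω k j => ε ((n : ℤ) - (k : ℕ)) j ω
  have hYm : ∀ K, Measurable (Y K) := fun K => measurable_pi_lambda _ fun k => hεm _
  have hTm : ∀ K i, Measurable fun y : Fin K → Fin p → ℝ => G (truncatedProcess μ A i y) :=
    fun K i => hGc.measurable.comp (measurable_truncatedProcess μ A i)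
  let f : ℕ → ℕ → Ω → ℝ := fun K i ω => G (truncatedProcess μ A i (Y K ω))
  have hfm : ∀ K i, Measurable (f K i) := fun K i => (hTm K i).comp (hYm K)
  have hlaw : ∀ K, P.map (Y K) =
      Measure.pi fun k : Fin K => P.map fun ω j => ε ((n : ℤ) - (k : ℕ)) j ω := by
    intro K
    have h1 := (iIndepFun_rows hε.measurable hε.indep).precomp
      (g := fun k : Fin K => (n : ℤ) - (k : ℕ)) fun a b hab => by
        simp only at hab
        omega
    exact (iIndepFun_iff_map_fun_eq_pi_map fun k => (hεm _).aemeasurable).1 h1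
  have htrunc : ∀ K, ∫ ω, Real.exp (t * ∑ i ∈ Finset.range n,
      (f K i ω - ∫ ω', f K i ω' ∂P)) ∂P ≤
      Real.exp (2 * σ ^ 2 * γ ^ 2 * Real.exp α * (Real.exp 1 / α) ^ 2 * (n + 1 / α) *
        (t ^ 2 / (1 - t * (2 * M * Real.exp 1 / α)))) := by
    intro K
    have hprob : ∀ k : Fin K, IsProbabilityMeasure (P.map fun ω j => ε ((n : ℤ) - (k : ℕ)) j ω) :=
      fun k => Measure.isProbabilityMeasure_map (hεm _).aemeasurable
    have h1 := integral_exp_truncatedProcess_le (n := n)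
      (fun k : Fin K => P.map fun ω j => ε ((n : ℤ) - (k : ℕ)) j ω)
      (fun k => hε.isWhiteNoiseLaw _) μ hα ht hA hGM hg hg_sum hGLip hlt
    rw [← hlaw K] at h1
    have h2 : ∀ i, ∫ y, G (truncatedProcess μ A i y) ∂(P.map (Y K)) = ∫ ω, f K i ω ∂P := fun i =>
      integral_map (hYm K).aemeasurable (hTm K i).aestronglyMeasurable
    simp_rw [h2] at h1
    rw [integral_map (hYm K).aemeasurable (Measurable.aestronglyMeasurable
      (((Finset.measurable_sum _ fun i _ => (hTm K i).sub_const _).const_mul t).exp))] at h1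
    exact h1
  have hlim : ∀ i : ℕ, ∀ᵐ ω ∂P,
      Tendsto (fun K => f K i ω) atTop (𝓝 (G (X ((n : ℤ) - i) ω))) := by
    intro i
    filter_upwards [hX ((n : ℤ) - i)] with ω hω
    refine (hGc.tendsto _).comp ?_
    have h1 := hω.comp (tendsto_sub_atTop_nat i)
    refine h1.congr fun K => ?_
    exact (truncatedProcess_innovations μ A (fun m j => ε m j ω) n i).symm
  have hlimInt : ∀ i : ℕ, Tendsto (fun K => ∫ ω, f K i ω ∂P) atTop
      (𝓝 (∫ ω, G (X ((n : ℤ) - i) ω) ∂P)) := fun i =>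
    tendsto_integral_of_dominated_convergence (fun _ => M)
      (fun K => (hfm K i).aestronglyMeasurable) (integrable_const M)
      (fun K => ae_of_all _ fun ω => (Real.norm_eq_abs _).trans_le (hGM _)) (hlim i)
  have hall : ∀ᵐ ω ∂P, Tendsto (fun K => Real.exp (t * ∑ i ∈ Finset.range n,
      (f K i ω - ∫ ω', f K i ω' ∂P))) atTop (𝓝 (Real.exp (t * ∑ i ∈ Finset.range n,
        (G (X ((n : ℤ) - i) ω) - ∫ ω', G (X ((n : ℤ) - i) ω') ∂P)))) := by
    filter_upwards [ae_all_iff.2 hlim] with ω hω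
    exact (Real.continuous_exp.tendsto _).comp
      ((tendsto_finsetSum _ fun i _ => (hω i).sub (hlimInt i)).const_mul t)
  have hmeas : ∀ K, AEStronglyMeasurable (fun ω => Real.exp (t * ∑ i ∈ Finset.range n,
      (f K i ω - ∫ ω', f K i ω' ∂P))) P := fun K =>
    Measurable.aestronglyMeasurable (by fun_prop)
  have hbound : ∀ u v : ℕ → ℝ, (∀ i, |u i| ≤ M) → (∀ i, |v i| ≤ M) →
      ‖Real.exp (t * ∑ i ∈ Finset.range n, (u i - v i))‖ ≤
        Real.exp (t * ∑ i ∈ Finset.range n, (2 * M)) := by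
    intro u v hu hv
    rw [Real.norm_eq_abs, Real.abs_exp]
    refine Real.exp_le_exp.2 (mul_le_mul_of_nonneg_left (Finset.sum_le_sum fun i _ => ?_) ht)
    have := abs_le.1 (hu i)
    have := abs_le.1 (hv i)
    linarith
  refine ⟨Integrable.of_bound (aestronglyMeasurable_of_tendsto_ae atTop hmeas hall)
    (Real.exp (t * ∑ i ∈ Finset.range n, (2 * M)))
    (ae_of_all _ fun ω => hbound _ _ (fun i => hGM _)
      fun i => abs_integral_le_of_abs_le fun ω => hGM _), ?_⟩
  refine le_of_tendsto' (tendsto_integral_of_dominated_convergence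
    (fun _ => Real.exp (t * ∑ i ∈ Finset.range n, (2 * M))) hmeas (integrable_const _)
    (fun K => ae_of_all _ fun ω => hbound _ _ (fun i => hGM _)
      fun i => abs_integral_le_of_abs_le fun ω => hGM _) hall) htrunc

/-! ### Chernoff's inequality -/

/-- Optimizing a sub-gamma exponential moment bound in the Chernoff inequality. -/
theorem measure_ge_le_of_subgamma {Ω : Type*} [MeasurableSpace Ω] {P : Measure Ω}
    [IsProbabilityMeasure P] {S : Ω → ℝ} {B b x : ℝ} (hx : 0 < x) (hB : 0 ≤ B) (hb : 0 ≤ b)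
    (hpos : 0 < 2 * B + b * x)
    (h : ∀ t, 0 ≤ t → t * b < 1 → Integrable (fun ω => Real.exp (t * S ω)) P ∧
      ∫ ω, Real.exp (t * S ω) ∂P ≤ Real.exp (B * (t ^ 2 / (1 - t * b)))) :
    P.real {ω | x ≤ S ω} ≤ 2 * Real.exp (-(x ^ 2 / (4 * B + 2 * b * x))) := by
  rcases hB.eq_or_lt with rfl | hB'
  · -- With no variance term the usual choice of `t` is the excluded endpoint; take half of it.
    have hb' : 0 < b := by
      by_contra hneg
      have : b = 0 := le_antisymm (not_lt.1 hneg) hb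
      simp [this] at hpos
    obtain ⟨hi, hle⟩ := h (1 / (2 * b)) (by positivity) (by field_simp; norm_num)
    refine (measure_ge_le_exp_mul_mgf x (by positivity) hi).trans ?_
    have h1 : mgf S P (1 / (2 * b)) ≤ 1 := hle.trans_eq (by simp)
    calc Real.exp (-(1 / (2 * b)) * x) * mgf S P (1 / (2 * b))
        ≤ Real.exp (-(1 / (2 * b)) * x) * 1 :=
          mul_le_mul_of_nonneg_left h1 (Real.exp_pos _).le
      _ = Real.exp (-(x ^ 2 / (4 * 0 + 2 * b * x))) := by
          rw [mul_one]
          congr 1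
          field_simp
          ring
      _ ≤ _ := by linarith [Real.exp_pos (-(x ^ 2 / (4 * 0 + 2 * b * x)))]
  -- For this `t`, `1 - t * b = 2 * B / (2 * B + b * x)`, so the log-moment bound equals `t * x / 2`
  -- and half of the Chernoff exponent survives.
  · set t := x / (2 * B + b * x) with htdef
    have ht : 0 ≤ t := by positivity
    have h1t : 1 - t * b = 2 * B / (2 * B + b * x) := by
      rw [htdef]
      field_simp
      ring
    have hlt : t * b < 1 := by
      have : 0 < 2 * B / (2 * B + b * x) := by positivity
      linarith
    obtain ⟨hi, hle⟩ := h t ht hlt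
    refine (measure_ge_le_exp_mul_mgf x ht hi).trans ?_
    calc Real.exp (-t * x) * mgf S P t
        ≤ Real.exp (-t * x) * Real.exp (B * (t ^ 2 / (1 - t * b))) :=
          mul_le_mul_of_nonneg_left hle (Real.exp_pos _).le
      _ = Real.exp (-(x ^ 2 / (4 * B + 2 * b * x))) := by
          rw [← Real.exp_add, h1t, htdef,
            show 4 * B + 2 * b * x = 2 * (2 * B + b * x) by ring]
          congr 1
          field_simp
          ring
      _ ≤ _ := by linarith [Real.exp_pos (-(x ^ 2 / (4 * B + 2 * b * x)))]

/-! ### Comparison of constants and conclusion -/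

theorem sum_Icc_one_eq_sum_range_sub (n : ℕ) (h : ℤ → ℝ) :
    ∑ i ∈ Finset.Icc (1 : ℤ) (n : ℤ), h i = ∑ i ∈ Finset.range n, h ((n : ℤ) - i) := by
  refine Finset.sum_nbij' (fun i => ((n : ℤ) - i).toNat) (fun i => (n : ℤ) - i) ?_ ?_ ?_ ?_ ?_
  · intro i hi
    simp only [Finset.mem_Icc, Finset.mem_range] at hi ⊢
    omega
  · intro i hi
    simp only [Finset.mem_Icc, Finset.mem_range] at hi ⊢
    omega
  · intro i hi
    simp only [Finset.mem_Icc] at hi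
    omega
  · intro i hi
    simp
  · intro i hi
    simp only [Finset.mem_Icc] at hi
    congr 1
    omega

/-- With `L = log(1/ρ₀)`, `τ ≥ 1` gives `exp (2 L / τ) ≤ ρ₀⁻²`, while `τ ≤ n` and `1 + 2 L ≤ exp (2
L) = ρ₀⁻²` control `n + 1/α`. Together they produce `ρ₀⁻⁴ L⁻³` with constant `e²`; the factor `16 /
√(2π) ≥ 1` in `bernsteinC₁` is slack. -/
theorem variance_proxy_le {n : ℕ} {σ ρ₀ τ γ : ℝ} (hρ₀ : 0 < ρ₀) (hρ₀_lt : ρ₀ < 1) (hτ : 1 ≤ τ)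
    (hτn : τ ≤ (n : ℝ)) :
    4 * (2 * σ ^ 2 * γ ^ 2 * Real.exp (2 * Real.log (1 / ρ₀) / τ) *
      (Real.exp 1 / (2 * Real.log (1 / ρ₀) / τ)) ^ 2 *
        (n + 1 / (2 * Real.log (1 / ρ₀) / τ))) ≤
      bernsteinC₁ ρ₀ * n * σ ^ 2 * τ ^ 2 * γ ^ 2 := by
  unfold bernsteinC₁
  set L := Real.log (1 / ρ₀) with hL
  have hL0 : 0 < L := Real.log_pos (by rw [lt_div_iff₀ hρ₀]; linarith)
  have hτ0 : 0 < τ := by linarith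
  have hexp2 : Real.exp (2 * L) = 1 / ρ₀ ^ 2 := by
    rw [mul_comm, show L * 2 = L + L by ring, Real.exp_add, hL, Real.exp_log (by positivity)]
    field_simp
  have h1 : Real.exp (2 * L / τ) ≤ 1 / ρ₀ ^ 2 := by
    rw [← hexp2]
    refine Real.exp_le_exp.2 (div_le_self (by positivity) hτ)
  have h2 : (n : ℝ) + 1 / (2 * L / τ) ≤ n * (1 / ρ₀ ^ 2) / (2 * L) := by
    have h3 := Real.add_one_le_exp (2 * L)
    rw [hexp2] at h3
    have hn : (0 : ℝ) ≤ n := Nat.cast_nonneg n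
    rw [le_div_iff₀ (by positivity)]
    calc ((n : ℝ) + 1 / (2 * L / τ)) * (2 * L) = n * (2 * L) + τ := by field_simp
      _ ≤ n * (2 * L + 1) := by linarith
      _ ≤ n * (1 / ρ₀ ^ 2) := mul_le_mul_of_nonneg_left h3 hn
  have hsqrt : Real.sqrt (2 * Real.pi) ≤ 16 := by
    rw [Real.sqrt_le_left (by norm_num)]
    linarith [Real.pi_le_four]
  have hsqrt0 : 0 < Real.sqrt (2 * Real.pi) := Real.sqrt_pos.2 (by positivity)
  calc _ ≤ 4 * (2 * σ ^ 2 * γ ^ 2 * (1 / ρ₀ ^ 2) * (Real.exp 1 / (2 * L / τ)) ^ 2 *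
        (n * (1 / ρ₀ ^ 2) / (2 * L))) := by gcongr
    _ = Real.exp 1 ^ 2 / (ρ₀ ^ 4 * L ^ 3) * n * σ ^ 2 * τ ^ 2 * γ ^ 2 * 1 := by
        field_simp
        ring
    _ ≤ Real.exp 1 ^ 2 / (ρ₀ ^ 4 * L ^ 3) * n * σ ^ 2 * τ ^ 2 * γ ^ 2 *
        (16 / Real.sqrt (2 * Real.pi)) := by
        refine mul_le_mul_of_nonneg_left ?_ (by positivity)
        rwa [one_le_div hsqrt0]
    _ = _ := by
        field_simp

theorem theorem2p1 {Ω : Type*} [MeasurableSpace Ω] (P : Measure Ω) [IsProbabilityMeasure P]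
    (p n : ℕ) (μ : Fin p → ℝ) (A : ℕ → Matrix (Fin p) (Fin p) ℝ)
    (ε : ℤ → Fin p → Ω → ℝ) (X : ℤ → Ω → Fin p → ℝ)
    (σ ρ₀ τ γ M : ℝ)
    (hε : IsIIDInnovation P σ ε)
    (hX : IsLinearProcess P μ A ε X)
    (hρ₀ : 0 < ρ₀) (hρ₀_lt : ρ₀ < 1)
    (hτ : 1 ≤ τ) (hτn : τ ≤ (n : ℝ))
    (hA : ∀ k : ℕ, matSpectralNorm (A k) ≤ γ * ρ₀ ^ ((k : ℝ) / τ))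
    (G : (Fin p → ℝ) → ℝ) (hGM : ∀ u, |G u| ≤ M)
    (g : Fin p → ℝ) (hg : ∀ j, 0 ≤ g j) (hg_sum : ∑ j, g j = 1)
    (hGLip : ∀ u v : Fin p → ℝ, |G u - G v| ≤ ∑ j, g j * |u j - v j|)
    (x : ℝ) (hx : 0 < x) :
    P.real {ω | x ≤ ∑ i ∈ Finset.Icc (1 : ℤ) (n : ℤ), (G (X i ω) - ∫ ω', G (X i ω') ∂P)} ≤
      2 * Real.exp (-(x ^ 2 /
        (bernsteinC₁ ρ₀ * n * σ ^ 2 * τ ^ 2 * γ ^ 2 + bernsteinC₂ ρ₀ * τ * M * x))) := by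
  have hL0 : 0 < Real.log (1 / ρ₀) := Real.log_pos (by rw [lt_div_iff₀ hρ₀]; linarith)
  have hτ0 : 0 < τ := by linarith
  have hM : 0 ≤ M := (abs_nonneg _).trans (hGM 0)
  -- The decay rate of the squared norms: `ρ₀ ^ (2 k / τ) = exp (-(α * k))`.
  set α := 2 * Real.log (1 / ρ₀) / τ with hαdef
  have hα : 0 < α := by positivity
  have hA2 : ∀ k : ℕ, matSpectralNorm (A k) ^ 2 ≤ γ ^ 2 * Real.exp (-(α * k)) := by
    intro k
    refine (pow_le_pow_left₀ (norm_nonneg _) (hA k) 2).trans_eq ?_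
    rw [mul_pow, Real.rpow_def_of_pos hρ₀, ← Real.exp_nat_mul, hαdef, one_div, Real.log_inv]
    congr 2
    push_cast
    field_simp
  set B := 2 * σ ^ 2 * γ ^ 2 * Real.exp α * (Real.exp 1 / α) ^ 2 * (n + 1 / α) with hB
  have hB0 : 0 ≤ B := by positivity
  set b := 2 * M * Real.exp 1 / α with hb
  have hb0 : 0 ≤ b := by positivity
  have hBle : 4 * B ≤ bernsteinC₁ ρ₀ * n * σ ^ 2 * τ ^ 2 * γ ^ 2 :=
    variance_proxy_le hρ₀ hρ₀_lt hτ hτn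
  -- The Chernoff step needs only `2 * b * x`, so this term has a factor 4 to spare.
  have hble : 8 * b * x = bernsteinC₂ ρ₀ * τ * M * x := by
    rw [hb, hαdef, bernsteinC₂]
    field_simp
  rcases hM.eq_or_lt with rfl | hM0
  -- For `M = 0` the quantity `2 * B + b * x` can vanish, so the Chernoff step may be unavailable;
  -- but then `G` is zero and the event is empty because `x > 0`.
  · have hG : ∀ u, G u = 0 := fun u => abs_nonpos_iff.1 (hGM u)
    have hempty : {ω | x ≤ ∑ i ∈ Finset.Icc (1 : ℤ) (n : ℤ),
        (G (X i ω) - ∫ ω', G (X i ω') ∂P)} = ∅ := by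
      ext ω
      simpa [hG] using hx
    rw [hempty, measureReal_empty]
    positivity
  · have hbpos : 0 < b := by positivity
    simp_rw [sum_Icc_one_eq_sum_range_sub n]
    refine (measure_ge_le_of_subgamma hx hB0 hb0 (by positivity) fun t ht hlt =>
      integral_exp_linearProcess_le hε hX hα ht hA2 hGM hg hg_sum hGLip hlt).trans ?_
    refine mul_le_mul_of_nonneg_left (Real.exp_le_exp.2 (neg_le_neg ?_)) zero_le_two
    refine div_le_div_of_nonneg_left (sq_nonneg x) (by positivity) ?_
    rw [← hble]
    have : 0 < b * x := by positivity
    linarith
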